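/- Let $\mathbf W:\mathbb R\to\mathbb C^{N\times N}$ be a matrix weight, positive definite (Hermitian) at every $x\in\mathbb R$, all of whose moments $\int_{\mathbb R}x^k\mathbf W(x)\,dx$ ($k\ge 0$) converge absolutely (entrywise). Suppose that $\mathbf W(x)=\mathbf T(x)\mathbf T(x)^*$ for $x\in\mathbb R$, where $\mathbf T$ is differentiable and $\mathbf T'(x)=\mathbf G(x)\mathbf T(x)$ on $\mathbb R$ for a matrix polynomial $\mathbf G(z)=\sum_{i=0}^m\mathbf M_iz^i$ of degree $m$. For a matrix polynomial $\mathbf Q$ put $\mathbf Q^*(z)=(\mathbf Q(\bar z))^*$, where $*$ on matrices is the conjugate transpose, and write $\mathbf Q^{-*}(z)=(\mathbf Q^*(z))^{-1}$. Let $\widehat{\mathbf P}_n(z)=z^n\mathbf I+\sum_{j<n}\mathbf a_{n,j}z^j$ ($n\ge0$) be the monic matrix polynomials orthogonal with respect to $\mathbf W$, i.e. $\int_{\mathbb R}\widehat{\mathbf P}_n\mathbf W\mathbf Q^*\,dx=\mathbf 0$ for every matrix polynomial $\mathbf Q$ of degree less than $n$. Put $\mathbf a_{n,n}=\mathbf I$,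 $\mathbf a_{n,j}=\mathbf 0$ for $j<0$, and $$\boldsymbol\gamma_n=\Big(\int_{\mathbb R}\widehat{\mathbf P}_n\mathbf W\widehat{\mathbf P}_n^*dx\Big)^{-1},\qquad \boldsymbol\alpha_n=\mathbf a_{n,n-1}-\mathbf a_{n+1,n},\qquad \boldsymbol\beta_n=\boldsymbol\gamma_n^{-1}\boldsymbol\gamma_{n-1}\ (n\ge1),\quad \boldsymbol\beta_0=\mathbf 0,$$ $$\mathbf b_{n,k}=\int_{\mathbb R}x^k\widehat{\mathbf P}_n(x)\mathbf W(x)\,dx\ (k\ge n),\qquad \mathbf b_{n,k}=\mathbf 0\ (k<n),$$ $$\boldsymbol\Delta_{j,n}(z)=\sum_{k=0}^{j}\Big(\sum_{s=0}^{k}\mathbf a_{n,n-s}z^{k-s}\Big)\mathbf M_{m-j+k}\qquad(0\le j\le m),$$ $$\mathcal A_n(z)=-\boldsymbol\gamma_n\sum_{j=0}^{m-1}\big(\mathbf b_{n,n+m-j-1}\boldsymbol\Delta_{j,n}^*(z)+\boldsymbol\Delta_{j,n}(z)\mathbf b_{n,n+m-j-1}^*\big)\qquad(n\ge0),$$ $$\mathcal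 B_n(z)=-\sum_{j=0}^{m}\big(\boldsymbol\Delta_{j,n}(z)\mathbf b_{n-1,n+m-j-1}^*+\mathbf b_{n,n+m-j-2}\boldsymbol\Delta_{j,n-1}^*(z)\big)\boldsymbol\gamma_{n-1}\quad(n\ge1),\qquad \mathcal B_0(z)=-\mathbf G(z).$$ Then for every $n\ge0$ and every $z\in\mathbb C$ at which $\mathcal A_n(z)$ is invertible, $$\widehat{\mathbf P}_n''+2\widehat{\mathbf P}_n'\mathbf G+\widehat{\mathbf P}_n(\mathbf G'+\mathbf G^2)+\mathcal M_n\widehat{\mathbf P}_n'+\mathcal N_n\widehat{\mathbf P}_n+\mathcal M_n\widehat{\mathbf P}_n\mathbf G=\mathbf 0$$ holds at $z$, where $$\mathcal M_n(z)=-(\mathcal A_n^*)'(z)\mathcal A_n^{-*}(z)+\mathcal B_n(z)-\mathcal A_n^*(z)(z\mathbf I-\boldsymbol\alpha_n)+\mathcal A_n^*(z)\mathcal B_{n+1}(z)\mathcal A_n^{-*}(z),$$ $$\mathcal N_n(z)=\mathcal M_n(z)\mathcal B_n(z)-\mathcal B_n(z)^2+\mathcal B_n'(z)+\mathcal A_n^*(z)\boldsymbol\beta_n\mathcal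 A_{n-1}^*(z),$$ the last term being $\mathbf 0$ for $n=0$. In particular, if $\mathcal A_n(z)$ is invertible for all $z\in\mathbb C$, the equation holds on all of $\mathbb C$. -/

import Mathlib

open Polynomial
open scoped ComplexOrder

namespace MOPRL

/-- Complex `N × N` matrices. -/
abbrev Mat (N : ℕ) := Matrix (Fin N) (Fin N) ℂ

noncomputable section

variable {N : ℕ}

/-- The value `∑ Aₖ zᵏ` of the matrix polynomial `∑ Aₖ Xᵏ` at the scalar `z`. -/
def evalAt (p : (Mat N)[X]) (z : ℂ) : Mat N := p.eval (z • (1 : Mat N))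

/-- The matrix polynomial `∑ (Aₖ)ᴴ Xᵏ`, that is `z ↦ (p (conj z))ᴴ`; see `evalAt_starPoly`. -/
def starPoly (p : (Mat N)[X]) : (Mat N)[X] :=
  ∑ k ∈ Finset.range (p.natDegree + 1), monomial k (p.coeff k).conjTranspose

theorem evalAt_eq_sum (p : (Mat N)[X]) (z : ℂ) :
    evalAt p z = ∑ k ∈ Finset.range (p.natDegree + 1), z ^ k • p.coeff k := by
  simp [evalAt, eval_eq_sum_range, _root_.smul_pow]

theorem evalAt_starPoly (p : (Mat N)[X]) (z : ℂ) :
    evalAt (starPoly p) z = (evalAt p (starRingEnd ℂ z)).conjTranspose := by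
  rw [evalAt_eq_sum p, evalAt, starPoly, eval_finsetSum, Matrix.conjTranspose_sum]
  refine Finset.sum_congr rfl fun k _ => ?_
  simp [eval_monomial, _root_.smul_pow, Matrix.conjTranspose_smul]

/-- Entrywise integral over `ℝ` of a matrix-valued function. -/
def matIntegral (F : ℝ → Mat N) : Mat N := Matrix.of fun i j => ∫ x, F x i j

/-- `(P, Q)_W = ∫ P(x) W(x) Q(x)ᴴ dx`. -/
def innerW (W : ℝ → Mat N) (P Q : (Mat N)[X]) : Mat N :=
  matIntegral fun x => evalAt P x * W x * (evalAt Q x).conjTranspose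

/-- `W` is a weight matrix on `ℝ`: positive definite everywhere, with finite moments. -/
structure IsWeight (W : ℝ → Mat N) : Prop where
  posDef : ∀ x, (W x).PosDef
  moments : ∀ (k : ℕ) (i j : Fin N), MeasureTheory.Integrable fun x : ℝ => (x : ℂ) ^ k * W x i j

/-- `P` is the sequence of monic orthogonal matrix polynomials of `W`: `P n` has degree `n` and
leading coefficient `1`, and is orthogonal to every matrix polynomial of degree less than `n`. -/
structure IsMonicMOPRL (W : ℝ → Mat N) (P : ℕ → (Mat N)[X]) : Prop where
  natDegree_le : ∀ n, (P n).natDegree ≤ n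
  coeff_self : ∀ n, (P n).coeff n = 1
  orthogonal : ∀ (n : ℕ) (Q : (Mat N)[X]), Q.degree < n → innerW W (P n) Q = 0

variable (W : ℝ → Mat N) (P : ℕ → (Mat N)[X]) (G : (Mat N)[X])

/-- The coefficient `γₙ = κₙᴴ κₙ`, where `κₙ (P n)` is orthonormal, i.e. `κₙ (Pₙ, Pₙ) κₙᴴ = 1`;
it is the inverse of `(Pₙ, Pₙ)`, see `gamma_eq`. -/
def gamma (n : ℕ) : Mat N := (innerW W (P n) (P n))⁻¹

theorem gamma_eq (n : ℕ) (κ : Mat N) (h : κ * innerW W (P n) (P n) * κ.conjTranspose = 1) :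
    κ.conjTranspose * κ = gamma W P n := by
  have h2 : κ.conjTranspose * (κ * innerW W (P n) (P n)) = 1 := mul_eq_one_comm.mp h
  rw [← Matrix.mul_assoc] at h2
  exact (Matrix.inv_eq_left_inv h2).symm

/-- `a_{n,n-s}`, the coefficient of `X ^ (n - s)` in `P n`; it is zero for `s > n`. -/
def coeffDown (n s : ℕ) : Mat N := if s ≤ n then (P n).coeff (n - s) else 0

/-- `αₙ = a_{n,n-1} - a_{n+1,n}`. -/
def alpha (n : ℕ) : Mat N := coeffDown P n 1 - coeffDown P (n + 1) 1

/-- `βₙ = γₙ⁻¹ γₙ₋₁` for `n ≥ 1`, and `β₀ = 0`. -/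
def beta : ℕ → Mat N
  | 0 => 0
  | n + 1 => (gamma W P (n + 1))⁻¹ * gamma W P n

/-- `b_{n,k} = ∫ xᵏ Pₙ(x) W(x) dx`; by orthogonality it is zero for `k < n`. -/
def bCoeff (n k : ℕ) : Mat N := matIntegral fun x => (x : ℂ) ^ k • (evalAt (P n) x * W x)

/-- `P_{n,k}(z) = zᵏ + a_{n,n-1} zᵏ⁻¹ + ⋯ + a_{n,n-k}`. -/
def truncPoly (n k : ℕ) : (Mat N)[X] :=
  ∑ s ∈ Finset.range (k + 1), monomial (k - s) (coeffDown P n s)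

/-- `Δ_{j,n}(z) = ∑_{k ≤ j} P_{n,k}(z) M_{m-j+k}`, where `G = ∑_{i ≤ m} Mᵢ zⁱ` has degree `m`
and `j ≤ m`. -/
def Delta (j n : ℕ) : (Mat N)[X] :=
  ∑ k ∈ Finset.range (j + 1), truncPoly P n k * C (G.coeff (G.natDegree - j + k))

/-- `𝒜ₙ(z; G) = -γₙ ∑_{j < m} (b_{n,n+m-j-1} Δ_{j,n}*(z) + Δ_{j,n}(z) b_{n,n+m-j-1}ᴴ)`,
with `m` the degree of `G`. -/
def calA (n : ℕ) : (Mat N)[X] :=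
  -(C (gamma W P n) * ∑ j ∈ Finset.range G.natDegree,
    (C (bCoeff W P n (n + G.natDegree - j - 1)) * starPoly (Delta P G j n)
      + Delta P G j n * C (bCoeff W P n (n + G.natDegree - j - 1)).conjTranspose))

/-- For `n ≥ 1` and `m` the degree of `G`,
`ℬₙ(z; G) = -(∑_{j ≤ m} (Δ_{j,n}(z) b_{n-1,n+m-j-1}ᴴ + b_{n,n+m-j-2} Δ_{j,n-1}*(z))) γₙ₋₁`
(written below with `n + 1` for `n`), and `ℬ₀(z; G) = -G(z)`. The second summand vanishes for
`j = m` and `j = m - 1`, since then its `b` has second index less than the first one; the truncated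
subtraction in the case `n = 1`, `j = m` is therefore harmless. -/
def calB : ℕ → (Mat N)[X]
  | 0 => -G
  | n + 1 =>
    -((∑ j ∈ Finset.range (G.natDegree + 1),
      (Delta P G j (n + 1) * C (bCoeff W P n (n + G.natDegree - j)).conjTranspose
        + C (bCoeff W P (n + 1) (n + G.natDegree - j - 1)) * starPoly (Delta P G j n)))
      * C (gamma W P n))

/-- `ℳₙ = -(𝒜ₙ*)' 𝒜ₙ⁻* + ℬₙ - 𝒜ₙ* (z - αₙ) + 𝒜ₙ* ℬₙ₊₁ 𝒜ₙ⁻*`, at the point `z`. -/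
def calM (n : ℕ) (z : ℂ) : Mat N :=
  -(evalAt (derivative (starPoly (calA W P G n))) z * (evalAt (starPoly (calA W P G n)) z)⁻¹)
    + evalAt (calB W P G n) z
    - evalAt (starPoly (calA W P G n)) z * (z • (1 : Mat N) - alpha P n)
    + evalAt (starPoly (calA W P G n)) z * evalAt (calB W P G (n + 1)) z
      * (evalAt (starPoly (calA W P G n)) z)⁻¹

/-- `𝒩ₙ = ℳₙ ℬₙ - ℬₙ² + ℬₙ' + 𝒜ₙ* βₙ 𝒜ₙ₋₁*`, at the point `z`; for `n = 0` the last term is absent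
because `β₀ = 0`. -/
def calN (n : ℕ) (z : ℂ) : Mat N :=
  calM W P G n z * evalAt (calB W P G n) z - evalAt (calB W P G n) z ^ 2
    + evalAt (derivative (calB W P G n)) z
    + evalAt (starPoly (calA W P G n)) z * beta W P n * evalAt (starPoly (calA W P G (n - 1))) z

end

end MOPRL

/-! The operator `covDeriv G`, P ↦ P' + P G, describes differentiation of P T. Since all moments of
W = T Tᴴ exist, ∫ (P T (Q T)ᴴ)' dx = 0, so this operator is skew-adjoint for `innerW`
(`innerW_covDeriv`). This is the only use of T; everything after it is algebra of orthogonal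
polynomials.

Applying skew-adjointness to Pₙ and the Christoffel-Darboux kernel at z, and replacing the kernel by
its closed form, writes (Pₙ' + Pₙ G)(z) in terms of Pₙ(z) and Pₙ₋₁(z) (`IsMonicMOPRL.ladder`). The
coefficients are values of `ladderForm`, a sesquilinear form built from divided differences.
Expanding these in powers of x shows that they are the explicit polynomials 𝒜ₙ* and ℬₙ
(`evalAt_starPoly_calA`, `evalAt_calB_succ`), giving the lowering relation `covDeriv_add_calB_mul`.

Inserting the three-term recurrence in `ladderForm` links neighbouring coefficients
(`ladderForm_raise`, `compatibility`). Differentiating the lowering relation and using its instance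
at n - 1 to remove Pₙ₋₁' leaves terms in Pₙ₋₁. The choice of ℳₙ makes them cancel; it requires only
that 𝒜ₙ* be invertible (`second_order_of_ladder`). -/

namespace MOPRL

/-! ### Evaluation of matrix polynomials at scalars -/

/-- Evaluation at the scalar matrix `z`, as a ring homomorphism. -/
noncomputable def evalHom {N : ℕ} (z : ℂ) : (Mat N)[X] →+* Mat N :=
  eval₂RingHom' (RingHom.id _) (z • (1 : Mat N)) fun a => by
    simp [Commute, SemiconjBy]

section Eval

variable {N : ℕ}

theorem evalHom_apply (z : ℂ) (p : (Mat N)[X]) : evalHom z p = evalAt p z := rfl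

@[simp] theorem evalAt_add (p q : (Mat N)[X]) (z : ℂ) :
    evalAt (p + q) z = evalAt p z + evalAt q z := map_add (evalHom z) p q

@[simp] theorem evalAt_sub (p q : (Mat N)[X]) (z : ℂ) :
    evalAt (p - q) z = evalAt p z - evalAt q z := map_sub (evalHom z) p q

@[simp] theorem evalAt_neg (p : (Mat N)[X]) (z : ℂ) :
    evalAt (-p) z = -evalAt p z := map_neg (evalHom z) p

@[simp] theorem evalAt_mul (p q : (Mat N)[X]) (z : ℂ) :
    evalAt (p * q) z = evalAt p z * evalAt q z := map_mul (evalHom z) p q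

@[simp] theorem evalAt_zero (z : ℂ) : evalAt (0 : (Mat N)[X]) z = 0 := map_zero (evalHom z)

@[simp] theorem evalAt_one (z : ℂ) : evalAt (1 : (Mat N)[X]) z = 1 := map_one (evalHom z)

@[simp] theorem evalAt_sum {ι : Type*} (s : Finset ι) (f : ι → (Mat N)[X]) (z : ℂ) :
    evalAt (∑ i ∈ s, f i) z = ∑ i ∈ s, evalAt (f i) z := map_sum (evalHom z) f s

@[simp] theorem evalAt_C (a : Mat N) (z : ℂ) : evalAt (C a) z = a := by simp [evalAt]

@[simp] theorem evalAt_X (z : ℂ) : evalAt (X : (Mat N)[X]) z = z • 1 := by simp [evalAt]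

@[simp] theorem evalAt_X_pow (k : ℕ) (z : ℂ) : evalAt (X ^ k : (Mat N)[X]) z = z ^ k • 1 := by
  rw [← evalHom_apply, map_pow, evalHom_apply, evalAt_X, _root_.smul_pow, one_pow]

@[simp] theorem evalAt_monomial (k : ℕ) (a : Mat N) (z : ℂ) :
    evalAt (monomial k a) z = z ^ k • a := by
  simp [evalAt, _root_.smul_pow]

/-- A matrix polynomial that vanishes at infinitely many scalars is zero. -/
theorem eq_zero_of_infinite_evalAt {p : (Mat N)[X]} {s : Set ℂ} (hs : s.Infinite)
    (h : ∀ z ∈ s, evalAt p z = 0) : p = 0 := by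
  suffices matPolyEquiv.symm p = 0 by simpa using this
  ext1 i j
  rw [Matrix.zero_apply]
  refine eq_zero_of_infinite_isRoot _ (hs.mono fun z hz => ?_)
  have := congrFun (congrFun (h z hz) i) j
  rw [← matPolyEquiv.apply_symm_apply p] at this
  have h2 := matPolyEquiv_eval (matPolyEquiv.symm p) z i j
  rw [Set.mem_ofPred_eq, IsRoot, ← h2, ← Matrix.zero_apply i j, ← this, evalAt,
    Matrix.smul_one_eq_diagonal]
  rfl

theorem evalAt_injective {p q : (Mat N)[X]} (h : ∀ z, evalAt p z = evalAt q z) : p = q :=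
  sub_eq_zero.1 <| eq_zero_of_infinite_evalAt Set.infinite_univ fun z _ => by simp [h z]

theorem hasDerivAt_evalAt (p : (Mat N)[X]) (x : ℝ) (i j : Fin N) :
    HasDerivAt (fun x : ℝ => evalAt p x i j) (evalAt (derivative p) x i j) x := by
  induction p using Polynomial.induction_on' with
  | add p q hp hq => simpa using hp.fun_add hq
  | monomial k a =>
    have h := ((hasDerivAt_pow k (x : ℂ)).comp_ofReal).mul_const (a i j)
    rcases k with _ | k
    · simpa [derivative_monomial] using h
    · have hk : (a * ((k : Mat N) + 1)) i j = a i j * (k + 1) := by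
        rw [← Nat.cast_succ, ← Nat.cast_succ, ← nsmul_eq_mul', Matrix.smul_apply, nsmul_eq_mul']
      simpa [derivative_monomial, hk, mul_comm, mul_left_comm] using h

end Eval

/-! ### The sesquilinear form of a weight -/

section Form

variable {N : ℕ} {W : ℝ → Mat N}

theorem hasDerivAt_mul_entry {A B : ℝ → Mat N} {A' B' : Mat N} {x : ℝ}
    (hA : ∀ i j, HasDerivAt (fun x => A x i j) (A' i j) x)
    (hB : ∀ i j, HasDerivAt (fun x => B x i j) (B' i j) x) (i j : Fin N) :
    HasDerivAt (fun x => (A x * B x) i j) ((A' * B x + A x * B') i j) x := by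
  simp only [Matrix.mul_apply, Matrix.add_apply, ← Finset.sum_add_distrib]
  exact HasDerivAt.fun_sum fun k _ => (hA i k).mul (hB k j)

theorem hasDerivAt_conjTranspose_entry {A : ℝ → Mat N} {A' : Mat N} {x : ℝ}
    (hA : ∀ i j, HasDerivAt (fun x => A x i j) (A' i j) x) (i j : Fin N) :
    HasDerivAt (fun x => (A x).conjTranspose i j) (A'.conjTranspose i j) x := by
  simpa using (hA j i).star

/-- The integrand of `innerW`. -/
noncomputable def integrandW (W : ℝ → Mat N) (P Q : (Mat N)[X]) (x : ℝ) : Mat N :=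
  evalAt P x * W x * (evalAt Q x).conjTranspose

theorem integrandW_add_left (P P' Q : (Mat N)[X]) (x : ℝ) :
    integrandW W (P + P') Q x = integrandW W P Q x + integrandW W P' Q x := by
  simp [integrandW, add_mul]

theorem integrandW_add_right (P Q Q' : (Mat N)[X]) (x : ℝ) :
    integrandW W P (Q + Q') x = integrandW W P Q x + integrandW W P Q' x := by
  simp [integrandW, mul_add]

theorem innerW_apply (P Q : (Mat N)[X]) (i j : Fin N) :
    innerW W P Q i j = ∫ x, integrandW W P Q x i j := rfl

/-- By additivity in both slots it suffices to treat monomials, where the entries are finite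
combinations of moments of W. -/
theorem IsWeight.integrable (hW : IsWeight W) (P Q : (Mat N)[X]) (i j : Fin N) :
    MeasureTheory.Integrable fun x => integrandW W P Q x i j := by
  induction P using Polynomial.induction_on' with
  | add P P' h h' => 
    simp only [integrandW_add_left, Matrix.add_apply]
    exact h.add h'
  | monomial k a =>
    induction Q using Polynomial.induction_on' with
    | add Q Q' h h' => 
      simp only [integrandW_add_right, Matrix.add_apply]
      exact h.add h'
    | monomial l b =>
      have h : (fun x : ℝ => integrandW W (monomial k a) (monomial l b) x i j) = fun x : ℝ =>
          ∑ s, ∑ t, a i t * star (b j s) * ((x : ℂ) ^ (k + l) * W x t s) := by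
        ext x
        simp only [integrandW, evalAt_monomial, Matrix.conjTranspose_smul, star_pow,
          Complex.star_def, Complex.conj_ofReal, Matrix.mul_apply, Matrix.smul_apply, smul_eq_mul,
          Matrix.conjTranspose_apply, Finset.sum_mul, pow_add]
        refine Finset.sum_congr rfl fun s _ => Finset.sum_congr rfl fun t _ => ?_
        ring
      rw [h]
      exact MeasureTheory.integrable_finsetSum _ fun s _ =>
        MeasureTheory.integrable_finsetSum _ fun t _ => (hW.moments _ _ _).const_mul _

theorem IsWeight.innerW_add_left (hW : IsWeight W) (P P' Q : (Mat N)[X]) :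
    innerW W (P + P') Q = innerW W P Q + innerW W P' Q := by
  ext i j
  simp only [innerW_apply, Matrix.add_apply, integrandW_add_left]
  exact MeasureTheory.integral_add (hW.integrable _ _ _ _) (hW.integrable _ _ _ _)

theorem IsWeight.innerW_conjTranspose (hW : IsWeight W) (P Q : (Mat N)[X]) :
    (innerW W P Q).conjTranspose = innerW W Q P := by
  ext i j
  rw [Matrix.conjTranspose_apply, innerW_apply, innerW_apply, Complex.star_def, ← integral_conj]
  congr 1
  ext x
  have h : (integrandW W P Q x).conjTranspose = integrandW W Q P x := by
    simp [integrandW, Matrix.conjTranspose_mul, (hW.posDef x).isHermitian.eq, mul_assoc]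
  rw [← h]
  rfl

theorem IsWeight.innerW_add_right (hW : IsWeight W) (P Q Q' : (Mat N)[X]) :
    innerW W P (Q + Q') = innerW W P Q + innerW W P Q' := by
  rw [← hW.innerW_conjTranspose, hW.innerW_add_left, Matrix.conjTranspose_add,
    hW.innerW_conjTranspose, hW.innerW_conjTranspose]

theorem IsWeight.innerW_C_mul_left (hW : IsWeight W) (a : Mat N) (P Q : (Mat N)[X]) :
    innerW W (C a * P) Q = a * innerW W P Q := by
  ext i j
  have h : ∀ x, integrandW W (C a * P) Q x = a * integrandW W P Q x := fun x => by
    simp [integrandW, mul_assoc]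
  simp only [innerW_apply, h, Matrix.mul_apply]
  rw [MeasureTheory.integral_finsetSum _ fun k _ => (hW.integrable _ _ _ _).const_mul _]
  simp only [MeasureTheory.integral_const_mul]

theorem IsWeight.innerW_C_mul_right (hW : IsWeight W) (a : Mat N) (P Q : (Mat N)[X]) :
    innerW W P (C a * Q) = innerW W P Q * a.conjTranspose := by
  rw [← hW.innerW_conjTranspose, hW.innerW_C_mul_left, Matrix.conjTranspose_mul,
    hW.innerW_conjTranspose]

theorem innerW_X_mul (P Q : (Mat N)[X]) : innerW W (X * P) Q = innerW W P (X * Q) := by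
  ext i j
  simp only [innerW_apply]
  congr 1
  ext x
  simp [integrandW, mul_assoc, Matrix.conjTranspose_smul]

theorem IsWeight.innerW_neg_left (hW : IsWeight W) (P Q : (Mat N)[X]) :
    innerW W (-P) Q = -innerW W P Q :=
  map_neg (AddMonoidHom.mk' (fun P => innerW W P Q) fun P P' => hW.innerW_add_left P P' Q) P

theorem IsWeight.innerW_neg_right (hW : IsWeight W) (P Q : (Mat N)[X]) :
    innerW W P (-Q) = -innerW W P Q :=
  map_neg (AddMonoidHom.mk' (fun Q => innerW W P Q) fun Q Q' => hW.innerW_add_right P Q Q') Q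

theorem IsWeight.innerW_sub_left (hW : IsWeight W) (P P' Q : (Mat N)[X]) :
    innerW W (P - P') Q = innerW W P Q - innerW W P' Q := by
  rw [sub_eq_add_neg, hW.innerW_add_left, hW.innerW_neg_left, sub_eq_add_neg]

theorem IsWeight.innerW_sub_right (hW : IsWeight W) (P Q Q' : (Mat N)[X]) :
    innerW W P (Q - Q') = innerW W P Q - innerW W P Q' := by
  rw [sub_eq_add_neg, hW.innerW_add_right, hW.innerW_neg_right, sub_eq_add_neg]

theorem IsWeight.innerW_sum_left (hW : IsWeight W) {ι : Type*} (s : Finset ι)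
    (F : ι → (Mat N)[X]) (Q : (Mat N)[X]) :
    innerW W (∑ i ∈ s, F i) Q = ∑ i ∈ s, innerW W (F i) Q :=
  map_sum (AddMonoidHom.mk' (fun P => innerW W P Q) fun P P' => hW.innerW_add_left P P' Q) F s

theorem IsWeight.innerW_sum_right (hW : IsWeight W) {ι : Type*} (s : Finset ι)
    (P : (Mat N)[X]) (F : ι → (Mat N)[X]) :
    innerW W P (∑ i ∈ s, F i) = ∑ i ∈ s, innerW W P (F i) :=
  map_sum (AddMonoidHom.mk' (fun Q => innerW W P Q) fun Q Q' => hW.innerW_add_right P Q Q') F s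

theorem IsWeight.innerW_scalar_mul (hW : IsWeight W) (z : ℂ) (P Q : (Mat N)[X]) :
    innerW W ((C (z • 1) - X) * P) Q = innerW W P ((C (starRingEnd ℂ z • 1) - X) * Q) := by
  rw [sub_mul, sub_mul, hW.innerW_sub_left, hW.innerW_sub_right, innerW_X_mul,
    hW.innerW_C_mul_left, hW.innerW_C_mul_right]
  simp [Matrix.conjTranspose_smul]

/-- The weight has a nondegenerate form: monic polynomials have an invertible square. -/
theorem IsWeight.isUnit_innerW_self (hW : IsWeight W) {P : (Mat N)[X]} {n : ℕ}
    (hP : P.coeff n = 1) : IsUnit (innerW W P P) := by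
  rw [← Matrix.mulVec_injective_iff_isUnit]
  refine (injective_iff_map_eq_zero (innerW W P P).mulVecLin).2 fun v hv => ?_
  have hv : (innerW W P P).mulVec v = 0 := hv
  set u : ℝ → Fin N → ℂ := fun x => (evalAt P x).conjTranspose.mulVec v with hu
  have hquad : ∀ x, star v ⬝ᵥ (integrandW W P P x).mulVec v = star (u x) ⬝ᵥ (W x).mulVec (u x) := by
    intro x
    simp only [hu, integrandW, Matrix.star_mulVec, Matrix.conjTranspose_conjTranspose,
      ← Matrix.mulVec_mulVec, Matrix.dotProduct_mulVec, Matrix.vecMul_vecMul]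
  have hint : MeasureTheory.Integrable
      fun x => star v ⬝ᵥ (integrandW W P P x).mulVec v := by
    simp only [dotProduct, Matrix.mulVec]
    exact MeasureTheory.integrable_finsetSum _ fun i _ => MeasureTheory.Integrable.const_mul
      (MeasureTheory.integrable_finsetSum _ fun j _ => (hW.integrable _ _ _ _).mul_const _) _
  have h0 : ∫ x, star v ⬝ᵥ (integrandW W P P x).mulVec v = 0 := by
    have : star v ⬝ᵥ (innerW W P P).mulVec v = 0 := by simp [hv]
    rw [← this]
    simp only [dotProduct, Matrix.mulVec, innerW_apply]
    rw [MeasureTheory.integral_finsetSum _ fun i _ => MeasureTheory.Integrable.const_mul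
      (MeasureTheory.integrable_finsetSum _ fun j _ => (hW.integrable _ _ _ _).mul_const _) _]
    refine Finset.sum_congr rfl fun i _ => ?_
    rw [MeasureTheory.integral_const_mul,
      MeasureTheory.integral_finsetSum _ fun j _ => (hW.integrable _ _ _ _).mul_const _]
    simp only [MeasureTheory.integral_mul_const]
  simp only [hquad] at hint h0
  have hre : ∫ x, RCLike.re (star (u x) ⬝ᵥ (W x).mulVec (u x)) = 0 := by
    rw [integral_re hint, h0]; simp
  rw [MeasureTheory.integral_eq_zero_iff_of_nonneg
    (fun x => (hW.posDef x).posSemidef.re_dotProduct_nonneg _) hint.re] at hre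
  have hae : ∀ᵐ x : ℝ, u x = 0 := by
    filter_upwards [hre] with x hx
    by_contra hne
    exact ((hW.posDef x).re_dotProduct_pos hne).ne' hx
  -- A conull subset of ℝ cannot be finite, so an almost everywhere identity already holds at
  -- infinitely many points.
  have hinf : {x : ℝ | u x = 0}.Infinite := by
    intro hfin
    have h1 := hfin.measure_zero MeasureTheory.volume
    have h2 : MeasureTheory.volume {x : ℝ | u x = 0}ᶜ = 0 := hae
    have h3 := MeasureTheory.measure_union_le (μ := MeasureTheory.volume)
      {x : ℝ | u x = 0} {x : ℝ | u x = 0}ᶜ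
    rw [Set.union_compl_self, h1, h2] at h3
    simp at h3
  -- Every row of `B.transpose` is vᴴ, which turns the vector identity vᴴ P(x) = 0 into a statement
  -- about a matrix polynomial. Its coefficient at n is `B.transpose`, hence v = 0.
  let B : Mat N := Matrix.of fun i _ => star (v i)
  have hB : C B.transpose * P = 0 := by
    refine eq_zero_of_infinite_evalAt (hinf.image Complex.ofReal_injective.injOn) ?_
    rintro _ ⟨x, hx, rfl⟩
    ext i j
    have := congrArg star (congrFun hx j)
    simpa [hu, B, Matrix.mul_apply, Matrix.mulVec, dotProduct, mul_comm] using this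
  have hBz := congrArg (fun Q => coeff Q n) hB
  simp only [coeff_C_mul, hP, mul_one, coeff_zero] at hBz
  ext i
  simpa [B] using congrFun (congrFun hBz i) i

/-- The covariant derivative `P' + P G`, for which `(P T)' = (P' + P G) T` when `T' = G T`. -/
noncomputable def covDeriv (G P : (Mat N)[X]) : (Mat N)[X] := derivative P + P * G

/-- The integrand is (P T)(Q T)ᴴ, and the two terms are the two halves of its derivative. A function
integrable on ℝ together with its derivative has derivative of integral zero, so no boundary
condition on W is needed. -/
theorem innerW_covDeriv {T : ℝ → Mat N} {G : (Mat N)[X]} (hW : IsWeight W)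
    (hWT : ∀ x : ℝ, W x = T x * (T x).conjTranspose)
    (hTG : ∀ x : ℝ, HasDerivAt T (evalAt G x * T x) x) (P Q : (Mat N)[X]) :
    innerW W (covDeriv G P) Q + innerW W P (covDeriv G Q) = 0 := by
  have hT : ∀ (x : ℝ) i j, HasDerivAt (fun x => T x i j) ((evalAt G x * T x) i j) x := fun x i j =>
    hasDerivAt_pi.1 (hasDerivAt_pi.1 (hTG x) i) j
  have hcov : ∀ (P : (Mat N)[X]) (x : ℝ) i j, HasDerivAt (fun x : ℝ => (evalAt P x * T x) i j)
      ((evalAt (covDeriv G P) x * T x) i j) x := fun P x i j => by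
    convert hasDerivAt_mul_entry (hasDerivAt_evalAt P x) (hT x) i j using 2
    simp [covDeriv, add_mul, mul_assoc]
  ext i j
  rw [Matrix.add_apply, innerW_apply, innerW_apply, Matrix.zero_apply,
    ← MeasureTheory.integral_add (hW.integrable _ _ _ _) (hW.integrable _ _ _ _)]
  refine MeasureTheory.integral_eq_zero_of_hasDerivAt_of_integrable
    (f := fun x => integrandW W P Q x i j) (fun x => ?_)
    ((hW.integrable _ _ _ _).add (hW.integrable _ _ _ _)) (hW.integrable _ _ _ _)
  have h := hasDerivAt_mul_entry (hcov P x) (hasDerivAt_conjTranspose_entry (hcov Q x)) i j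
  simpa only [integrandW, hWT, Matrix.conjTranspose_mul, mul_assoc, Matrix.add_apply] using h

end Form

/-! ### Divided differences -/

section DividedDifference

variable {N : ℕ}

theorem matPoly_mul_neg (p q : (Mat N)[X]) : p * -q = -(p * q) := mul_neg p q

theorem matPoly_neg_mul (p q : (Mat N)[X]) : -p * q = -(p * q) := neg_mul p q

theorem degree_C_mul_le (a : Mat N) (p : (Mat N)[X]) : (C a * p).degree ≤ p.degree := by
  simpa using degree_mul_le_of_le (degree_C_le (a := a)) (le_refl p.degree)

/-- The divided difference `(F(X) - F(z)) / (X - z)`. -/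
noncomputable def divDiff (z : ℂ) (F : (Mat N)[X]) : (Mat N)[X] := F /ₘ (X - C (z • 1))

theorem commute_C_sub_X (a : Mat N) (z : ℂ) :
    (C (z • 1) - X) * C a = C a * (C (z • 1) - X) := by
  rw [sub_mul, mul_sub, ← C_mul, ← C_mul, smul_one_mul, mul_smul_one, X_mul_C]

theorem C_sub_X_mul_divDiff (z : ℂ) (F : (Mat N)[X]) :
    (C (z • 1) - X) * divDiff z F = C (evalAt F z) - F := by
  -- For N = 0 the matrix ring is trivial and X - z does not have degree 1.
  rcases subsingleton_or_nontrivial (Mat N) with h | h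
  · exact Subsingleton.elim _ _
  have h1 := modByMonic_add_div F (X - C (z • (1 : Mat N)))
  have h2 := degree_modByMonic_lt F (monic_X_sub_C (z • (1 : Mat N)))
  rw [degree_X_sub_C] at h2
  obtain ⟨r, hr⟩ : ∃ r, F %ₘ (X - C (z • (1 : Mat N))) = C r :=
    ⟨_, eq_C_of_degree_le_zero (Order.le_of_lt_succ h2)⟩
  rw [hr] at h1
  have h3 := congrArg (fun p => evalAt p z) h1
  simp only [evalAt_add, evalAt_mul, evalAt_sub, evalAt_C, evalAt_X, sub_self, zero_mul,
    add_zero] at h3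
  rw [← h3, eq_sub_iff_add_eq]
  nth_rw 2 [← h1]
  rw [divDiff, sub_mul, sub_mul]
  abel

theorem divDiff_unique {z : ℂ} {F q : (Mat N)[X]} {r : Mat N}
    (h : (C (z • 1) - X) * q = C r - F) : divDiff z F = q := by
  rcases subsingleton_or_nontrivial (Mat N) with h' | h'
  · exact Subsingleton.elim _ _
  refine (div_modByMonic_unique q (C r) (monic_X_sub_C (z • (1 : Mat N))) ⟨?_, ?_⟩).1
  · rw [← neg_sub (C _) X, matPoly_neg_mul, h]; abel
  · rw [degree_X_sub_C]
    exact degree_C_le.trans_lt zero_lt_one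

theorem divDiff_add (z : ℂ) (F F' : (Mat N)[X]) :
    divDiff z (F + F') = divDiff z F + divDiff z F' := by
  refine divDiff_unique (r := evalAt F z + evalAt F' z) ?_
  rw [mul_add, C_sub_X_mul_divDiff, C_sub_X_mul_divDiff, C_add]
  abel

theorem divDiff_C_mul (z : ℂ) (a : Mat N) (F : (Mat N)[X]) :
    divDiff z (C a * F) = C a * divDiff z F := by
  refine divDiff_unique (r := a * evalAt F z) ?_
  rw [← mul_assoc, commute_C_sub_X, mul_assoc, C_sub_X_mul_divDiff, mul_sub, C_mul]

theorem divDiff_X_mul (z : ℂ) (F : (Mat N)[X]) :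
    divDiff z (X * F) = F + C (z • 1) * divDiff z F := by
  refine divDiff_unique (r := z • evalAt F z) ?_
  rw [mul_add, ← mul_assoc, commute_C_sub_X, mul_assoc, C_sub_X_mul_divDiff, mul_sub, ← C_mul,
    smul_one_mul, sub_mul, sub_eq_add_neg, sub_eq_add_neg]
  abel

theorem divDiff_C_sub_X_mul (z : ℂ) (F : (Mat N)[X]) :
    divDiff z ((C (z • 1) - X) * F) = -F := by
  refine divDiff_unique (r := 0) ?_
  rw [matPoly_mul_neg, C_0, zero_sub]

end DividedDifference

/-! ### Orthogonal polynomials -/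

section Orthogonal

variable {N : ℕ} {W : ℝ → Mat N} {P : ℕ → (Mat N)[X]}

theorem IsMonicMOPRL.degree_le (hP : IsMonicMOPRL W P) (n : ℕ) : (P n).degree ≤ n :=
  degree_le_of_natDegree_le (hP.natDegree_le n)

theorem IsMonicMOPRL.degree_lt (hP : IsMonicMOPRL W P) {k n : ℕ} (h : k < n) :
    (P k).degree < n :=
  (hP.degree_le k).trans_lt (by exact_mod_cast h)

theorem IsMonicMOPRL.apply_zero (hP : IsMonicMOPRL W P) : P 0 = 1 := by
  rw [eq_C_of_natDegree_le_zero (hP.natDegree_le 0), hP.coeff_self, C_1]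

theorem IsMonicMOPRL.orthogonal' (hP : IsMonicMOPRL W P) (hW : IsWeight W) {n : ℕ}
    {Q : (Mat N)[X]} (h : Q.degree < n) : innerW W Q (P n) = 0 := by
  rw [← hW.innerW_conjTranspose, hP.orthogonal n Q h, Matrix.conjTranspose_zero]

theorem IsMonicMOPRL.gamma_mul (hP : IsMonicMOPRL W P) (hW : IsWeight W) (n : ℕ) :
    gamma W P n * innerW W (P n) (P n) = 1 :=
  Matrix.nonsing_inv_mul _ ((Matrix.isUnit_iff_isUnit_det _).1
    (hW.isUnit_innerW_self (hP.coeff_self n)))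

theorem IsMonicMOPRL.mul_gamma (hP : IsMonicMOPRL W P) (hW : IsWeight W) (n : ℕ) :
    innerW W (P n) (P n) * gamma W P n = 1 := mul_eq_one_comm.1 (hP.gamma_mul hW n)

theorem gamma_conjTranspose (hW : IsWeight W) (n : ℕ) :
    (gamma W P n).conjTranspose = gamma W P n := by
  rw [gamma, Matrix.conjTranspose_nonsing_inv, hW.innerW_conjTranspose]

theorem IsMonicMOPRL.beta_succ (hP : IsMonicMOPRL W P) (hW : IsWeight W) (n : ℕ) :
    beta W P (n + 1) = innerW W (P (n + 1)) (P (n + 1)) * gamma W P n := by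
  rw [beta, Matrix.inv_eq_left_inv (hP.mul_gamma hW (n + 1))]

theorem IsMonicMOPRL.gamma_mul_beta (hP : IsMonicMOPRL W P) (hW : IsWeight W) (n : ℕ) :
    gamma W P (n + 1) * beta W P (n + 1) = gamma W P n := by
  rw [hP.beta_succ hW, ← mul_assoc, hP.gamma_mul hW, one_mul]

theorem IsMonicMOPRL.beta_mul_gamma (hP : IsMonicMOPRL W P) (hW : IsWeight W) (n : ℕ) :
    (beta W P (n + 1)).conjTranspose * gamma W P (n + 1) = gamma W P n := by
  have h := congrArg Matrix.conjTranspose (hP.gamma_mul_beta hW n)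
  rwa [Matrix.conjTranspose_mul, gamma_conjTranspose hW, gamma_conjTranspose hW] at h

theorem degree_lt_of_succ {F : (Mat N)[X]} {n : ℕ} (h : F.degree < (n + 1 : ℕ))
    (h0 : F.coeff n = 0) : F.degree < n := by
  rw [degree_lt_iff_coeff_zero] at h ⊢
  intro m hm
  rcases hm.eq_or_lt with rfl | hm
  · exact h0
  · exact h m hm

/-- Subtracting the leading coefficient times Pₙ lowers the degree. The remainder is orthogonal to
Pₙ, which identifies that coefficient as (F, Pₙ) γₙ. -/
theorem IsMonicMOPRL.expansion (hP : IsMonicMOPRL W P) (hW : IsWeight W) {n : ℕ}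
    {F : (Mat N)[X]} (hF : F.degree < n) :
    F = ∑ k ∈ Finset.range n, C (innerW W F (P k) * gamma W P k) * P k := by
  induction n generalizing F with
  | zero => simpa [degree_lt_iff_coeff_zero, Polynomial.ext_iff] using hF
  | succ n ih =>
    have hlt : (F - C (F.coeff n) * P n).degree < n := by
      refine degree_lt_of_succ ?_ (by simp [hP.coeff_self])
      refine (degree_sub_le _ _).trans_lt (max_lt hF ?_)
      exact (degree_C_mul_le _ _).trans_lt (hP.degree_lt n.lt_succ_self)
    have hn : innerW W F (P n) * gamma W P n = F.coeff n := by
      have h := hP.orthogonal' hW hlt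
      rw [hW.innerW_sub_left, hW.innerW_C_mul_left, sub_eq_zero] at h
      rw [h, mul_assoc, hP.mul_gamma hW, mul_one]
    rw [Finset.sum_range_succ, hn, ← sub_eq_iff_eq_add]
    refine (ih hlt).trans (Finset.sum_congr rfl fun k hk => ?_)
    rw [hW.innerW_sub_left, hW.innerW_C_mul_left,
      hP.orthogonal n _ (hP.degree_lt (Finset.mem_range.1 hk)), mul_zero, sub_zero]

theorem degree_X_mul_sub_lt (hP : IsMonicMOPRL W P) (n : ℕ) :
    degree (X * P n - P (n + 1)) < (n + 1 : ℕ) := by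
  refine degree_lt_of_succ ?_ (by simp [hP.coeff_self])
  refine (degree_sub_le _ _).trans_lt (max_lt ?_ (hP.degree_lt (n + 1).lt_succ_self))
  rw [degree_lt_iff_coeff_zero]
  rintro (_ | m) hm
  · simp
  · rw [coeff_X_mul]
    exact coeff_eq_zero_of_natDegree_lt ((hP.natDegree_le n).trans_lt (by omega))

theorem IsMonicMOPRL.innerW_succ_X_mul (hP : IsMonicMOPRL W P) (hW : IsWeight W) (n : ℕ) :
    innerW W (P (n + 1)) (X * P n) = innerW W (P (n + 1)) (P (n + 1)) := by
  rw [← sub_eq_zero, ← hW.innerW_sub_right]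
  exact hP.orthogonal _ _ (degree_X_mul_sub_lt hP n)

/-- The three-term recurrence. -/
theorem IsMonicMOPRL.X_mul (hP : IsMonicMOPRL W P) (hW : IsWeight W) (n : ℕ) :
    X * P n = P (n + 1) + C (alpha P n) * P n + C (beta W P n) * P (n - 1) := by
  have hlt : degree (X * P n - P (n + 1) - C (alpha P n) * P n) < n := by
    refine degree_lt_of_succ ?_ ?_
    · exact (degree_sub_le _ _).trans_lt (max_lt (degree_X_mul_sub_lt hP n)
        ((degree_C_mul_le _ _).trans_lt (hP.degree_lt n.lt_succ_self)))
    · rw [coeff_sub, coeff_C_mul, hP.coeff_self, mul_one]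
      rcases n with _ | n <;> simp [alpha, coeffDown]
  suffices h : X * P n - P (n + 1) - C (alpha P n) * P n = C (beta W P n) * P (n - 1) by
    rw [← h]; abel
  rcases n with _ | n
  · rw [beta, C_0, zero_mul, hP.expansion hW hlt, Finset.sum_range_zero]
  -- Multiplication by X is symmetric for the form, so the k-th coefficient is controlled by X Pₖ;
  -- its degree is too small unless k = n, the index just below n + 1.
  have hz : ∀ k < n + 1, innerW W (X * P (n + 1) - P (n + 1 + 1) - C (alpha P (n + 1)) * P (n + 1))
      (P k) = innerW W (P (n + 1)) (X * P k) := fun k hk => by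
    rw [hW.innerW_sub_left, hW.innerW_sub_left, hW.innerW_C_mul_left, innerW_X_mul,
      hP.orthogonal (n + 1) _ (hP.degree_lt hk),
      hP.orthogonal (n + 1 + 1) _ (hP.degree_lt (hk.trans (Nat.lt_succ_self _))), mul_zero,
      sub_zero, sub_zero]
  rw [hP.expansion hW hlt, Finset.sum_range_succ, hz n n.lt_succ_self, hP.innerW_succ_X_mul hW,
    ← hP.beta_succ hW, Finset.sum_eq_zero, zero_add, Nat.add_sub_cancel]
  intro k hk
  have hk := Finset.mem_range.1 hk
  have hdeg : degree (X * P k) < (n + 1 : ℕ) := by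
    have := degree_X_mul_sub_lt hP k
    rw [← sub_add_cancel (X * P k) (P (k + 1))]
    exact (degree_add_le _ _).trans_lt (max_lt (this.trans (by exact_mod_cast Nat.succ_lt_succ hk))
      (hP.degree_lt (by omega)))
  rw [hz k (by omega), hP.orthogonal _ _ hdeg, zero_mul, C_0, zero_mul]

/-- (X Pₙ, Pₙ) = αₙ (Pₙ, Pₙ) is Hermitian because multiplication by X is symmetric. -/
theorem IsMonicMOPRL.gamma_mul_alpha (hP : IsMonicMOPRL W P) (hW : IsWeight W) (n : ℕ) :
    (alpha P n).conjTranspose * gamma W P n = gamma W P n * alpha P n := by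
  have hb : beta W P n * innerW W (P (n - 1)) (P n) = 0 := by
    rcases n with _ | n
    · rw [beta, zero_mul]
    · rw [hP.orthogonal' hW (hP.degree_lt (by omega)), mul_zero]
  have h : innerW W (X * P n) (P n) = alpha P n * innerW W (P n) (P n) := by
    rw [hP.X_mul hW, hW.innerW_add_left, hW.innerW_add_left, hW.innerW_C_mul_left,
      hW.innerW_C_mul_left, hP.orthogonal _ _ (hP.degree_lt n.lt_succ_self), hb, zero_add,
      add_zero]
  have h2 := congrArg Matrix.conjTranspose h
  rw [hW.innerW_conjTranspose, ← innerW_X_mul, h, Matrix.conjTranspose_mul,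
    hW.innerW_conjTranspose] at h2
  calc (alpha P n).conjTranspose * gamma W P n
      = gamma W P n * (innerW W (P n) (P n) * (alpha P n).conjTranspose) * gamma W P n := by
        rw [← mul_assoc, hP.gamma_mul hW, one_mul]
    _ = gamma W P n * alpha P n := by
        rw [← h2, mul_assoc, mul_assoc, hP.mul_gamma hW, mul_one]

/-- The Christoffel-Darboux kernel `x ↦ (∑_{k < n} Pₖ(x)ᴴ γₖ Pₖ(z))ᴴ`. -/
noncomputable def cdKernel (W : ℝ → Mat N) (P : ℕ → (Mat N)[X]) (z : ℂ) (n : ℕ) : (Mat N)[X] :=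
  ∑ k ∈ Finset.range n, C ((evalAt (P k) z).conjTranspose * gamma W P k) * P k

theorem IsMonicMOPRL.degree_cdKernel (hP : IsMonicMOPRL W P) (z : ℂ) (n : ℕ) :
    (cdKernel W P z n).degree < n := by
  refine (degree_sum_le _ _).trans_lt ((Finset.sup_lt_iff (WithBot.bot_lt_coe n)).2 fun k hk => ?_)
  exact (degree_C_mul_le _ _).trans_lt (hP.degree_lt (Finset.mem_range.1 hk))

/-- The reproducing property, read off from the orthogonal expansion of F. The kernel stands in the
conjugated slot, hence the adjoints in its definition. -/
theorem IsMonicMOPRL.innerW_cdKernel (hP : IsMonicMOPRL W P) (hW : IsWeight W) (z : ℂ) {n : ℕ}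
    {F : (Mat N)[X]} (hF : F.degree < n) : innerW W F (cdKernel W P z n) = evalAt F z := by
  conv_rhs => rw [hP.expansion hW hF]
  rw [cdKernel, hW.innerW_sum_right, evalAt_sum]
  refine Finset.sum_congr rfl fun k _ => ?_
  rw [hW.innerW_C_mul_right, evalAt_mul, evalAt_C, Matrix.conjTranspose_mul,
    Matrix.conjTranspose_conjTranspose, gamma_conjTranspose hW, mul_assoc]

/-- Each summand, rewritten by the recurrences in z and in X, is a difference of consecutive terms
(`hstep`). The αₙ terms cancel by `gamma_mul_alpha`, and the βₙ terms telescope. -/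
theorem IsMonicMOPRL.christoffel_darboux (hP : IsMonicMOPRL W P) (hW : IsWeight W) (z : ℂ)
    (n : ℕ) :
    (C (starRingEnd ℂ z • 1) - X) * cdKernel W P z (n + 1) =
      C ((evalAt (P (n + 1)) z).conjTranspose * gamma W P n) * P n
        - C ((evalAt (P n) z).conjTranspose * gamma W P n) * P (n + 1) := by
  have hz : ∀ n, starRingEnd ℂ z • (evalAt (P n) z).conjTranspose =
      (evalAt (P (n + 1)) z).conjTranspose
        + (evalAt (P n) z).conjTranspose * (alpha P n).conjTranspose
        + (evalAt (P (n - 1)) z).conjTranspose * (beta W P n).conjTranspose := fun n => by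
    have h := congrArg (fun F => (evalAt F z).conjTranspose) (hP.X_mul hW n)
    simpa [Matrix.conjTranspose_smul] using h
  have hstep : ∀ n, (C (starRingEnd ℂ z • 1) - X) *
      (C ((evalAt (P n) z).conjTranspose * gamma W P n) * P n) =
      C ((evalAt (P (n + 1)) z).conjTranspose * gamma W P n) * P n
        - C ((evalAt (P n) z).conjTranspose * gamma W P n) * P (n + 1)
        + C ((evalAt (P (n - 1)) z).conjTranspose * ((beta W P n).conjTranspose * gamma W P n))
          * P n
        - C ((evalAt (P n) z).conjTranspose * (gamma W P n * beta W P n)) * P (n - 1) :=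
    fun n => by
      rw [← mul_assoc, commute_C_sub_X, mul_assoc, sub_mul, hP.X_mul hW, mul_sub, ← mul_assoc,
        ← C_mul, mul_smul_one, ← smul_mul_assoc, hz, add_mul, add_mul,
        mul_assoc _ (alpha P n).conjTranspose, hP.gamma_mul_alpha hW]
      simp only [C_add, C_mul]
      noncomm_ring
  induction n with
  | zero =>
    rw [cdKernel, Finset.sum_range_one, hstep, beta]
    simp
  | succ n ih =>
    rw [cdKernel, Finset.sum_range_succ, mul_add, ← cdKernel, ih, hstep, hP.beta_mul_gamma hW,
      hP.gamma_mul_beta hW, Nat.add_sub_cancel]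
    abel

end Orthogonal

/-! ### Ladder relation and compatibility -/

section Ladder

variable {N : ℕ} {W : ℝ → Mat N} {P : ℕ → (Mat N)[X]} {G : (Mat N)[X]}

/-- The matrix
`∫ (R(z) - R(x)) / (z - x) W Qᴴ + P W ((S(conj z) - S(x)) / (conj z - x))ᴴ dx`
with `R = P G` and `S = Q G`. -/
noncomputable def ladderForm (W : ℝ → Mat N) (G : (Mat N)[X]) (z : ℂ) (P Q : (Mat N)[X]) : Mat N :=
  innerW W (divDiff z (P * G)) Q + innerW W P (divDiff (starRingEnd ℂ z) (Q * G))

theorem ladderForm_conjTranspose (hW : IsWeight W) (z : ℂ) (P Q : (Mat N)[X]) :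
    (ladderForm W G (starRingEnd ℂ z) P Q).conjTranspose = ladderForm W G z Q P := by
  rw [ladderForm, ladderForm, Matrix.conjTranspose_add, hW.innerW_conjTranspose,
    hW.innerW_conjTranspose, Complex.conj_conj, add_comm]

theorem ladderForm_add_left (hW : IsWeight W) (z : ℂ) (P P' Q : (Mat N)[X]) :
    ladderForm W G z (P + P') Q = ladderForm W G z P Q + ladderForm W G z P' Q := by
  simp only [ladderForm, add_mul, divDiff_add, hW.innerW_add_left]
  abel

theorem ladderForm_C_mul_left (hW : IsWeight W) (z : ℂ) (a : Mat N) (P Q : (Mat N)[X]) :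
    ladderForm W G z (C a * P) Q = a * ladderForm W G z P Q := by
  simp only [ladderForm, mul_assoc, divDiff_C_mul, hW.innerW_C_mul_left, mul_add]

theorem ladderForm_X_mul_left (hW : IsWeight W) (z : ℂ) (P Q : (Mat N)[X]) :
    ladderForm W G z (X * P) Q = z • ladderForm W G z P Q + innerW W (P * G) Q
      + innerW W P (Q * G)
      - innerW W P 1 * (evalAt (Q * G) (starRingEnd ℂ z)).conjTranspose := by
  have h := C_sub_X_mul_divDiff (starRingEnd ℂ z) (Q * G)
  have h2 : X * divDiff (starRingEnd ℂ z) (Q * G) = C (starRingEnd ℂ z • 1)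
      * divDiff (starRingEnd ℂ z) (Q * G) - C (evalAt (Q * G) (starRingEnd ℂ z)) * 1 + Q * G := by
    rw [mul_one, sub_add, ← h, sub_mul]
    abel
  rw [ladderForm, ladderForm, mul_assoc, divDiff_X_mul, hW.innerW_add_left, hW.innerW_C_mul_left,
    innerW_X_mul, h2, hW.innerW_add_right, hW.innerW_sub_right, hW.innerW_C_mul_right,
    hW.innerW_C_mul_right]
  simp only [Matrix.conjTranspose_smul, Matrix.conjTranspose_one, Complex.star_def,
    Complex.conj_conj, smul_one_mul, mul_smul_one, smul_add]
  abel

/-- The left side is the form at (X Pₙ, Pₙ). Moving X through the divided differences produces (Pₙ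
G, Pₙ) + (Pₙ, Pₙ G), which vanishes by skew-adjointness, since Pₙ' is orthogonal to Pₙ. -/
theorem IsMonicMOPRL.ladderForm_recurrence (hP : IsMonicMOPRL W P) (hW : IsWeight W)
    (hD : ∀ F Q, innerW W (covDeriv G F) Q + innerW W F (covDeriv G Q) = 0) (z : ℂ) (n : ℕ) :
    ladderForm W G z (P (n + 1)) (P n) + alpha P n * ladderForm W G z (P n) (P n)
        + beta W P n * ladderForm W G z (P (n - 1)) (P n)
      = z • ladderForm W G z (P n) (P n)
        - innerW W (P n) 1 * (evalAt (P n * G) (starRingEnd ℂ z)).conjTranspose := by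
  have hd : (derivative (P n)).degree < n := by
    rcases n with _ | n
    · simp [hP.apply_zero]
    -- A monic polynomial vanishes only when N = 0.
    · rcases eq_or_ne (P (n + 1)) 0 with h | h
      · simp [h]
      · exact (degree_derivative_lt h).trans_le (hP.degree_le _)
  have h0 := hD (P n) (P n)
  rw [covDeriv, hW.innerW_add_left, hW.innerW_add_right, hP.orthogonal _ _ hd,
    hP.orthogonal' hW hd, zero_add, zero_add] at h0
  rw [← ladderForm_C_mul_left hW, ← ladderForm_C_mul_left hW, ← ladderForm_add_left hW,
    ← ladderForm_add_left hW, ← hP.X_mul hW, ladderForm_X_mul_left hW,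
    add_assoc (z • ladderForm W G z (P n) (P n)), h0, add_zero]

/-- With κ the kernel, reproduction gives P'(z) = (P', κ) for P = Pₙ₊₁, and (P, κ') = 0;
skew-adjointness turns this into -(P G, κ) - (P, κ G). Christoffel-Darboux converts the two pairings
into divided differences: `h1` also yields the term (P G)(z), `h2` does not. -/
theorem IsMonicMOPRL.ladder (hP : IsMonicMOPRL W P) (hW : IsWeight W)
    (hD : ∀ F Q, innerW W (covDeriv G F) Q + innerW W F (covDeriv G Q) = 0) (z : ℂ) (n : ℕ) :
    evalAt (covDeriv G (P (n + 1))) z =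
      ladderForm W G z (P (n + 1)) (P n) * gamma W P n * evalAt (P (n + 1)) z
        - ladderForm W G z (P (n + 1)) (P (n + 1)) * gamma W P n * evalAt (P n) z := by
  set κ := cdKernel W P z (n + 1) with hκ
  have hcd := hP.christoffel_darboux hW z n
  rw [← hκ] at hcd
  have hC : ∀ (F Q Q' : (Mat N)[X]),
      innerW W F (C ((evalAt Q z).conjTranspose * gamma W P n) * Q')
      = innerW W F Q' * gamma W P n * evalAt Q z := fun F Q Q' => by
    rw [hW.innerW_C_mul_right, Matrix.conjTranspose_mul, gamma_conjTranspose hW,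
      Matrix.conjTranspose_conjTranspose, mul_assoc]
  have h1 : innerW W (divDiff z (P (n + 1) * G)) (P n) * gamma W P n * evalAt (P (n + 1)) z
      - innerW W (divDiff z (P (n + 1) * G)) (P (n + 1)) * gamma W P n * evalAt (P n) z
      = evalAt (P (n + 1) * G) z - innerW W (P (n + 1) * G) κ := by
    rw [← hC, ← hC, ← hW.innerW_sub_right, ← hcd, ← hW.innerW_scalar_mul, C_sub_X_mul_divDiff,
      hW.innerW_sub_left, hκ, hP.innerW_cdKernel hW z
        (degree_C_le.trans_lt (by exact_mod_cast n.succ_pos)), evalAt_C]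
  have h2 : innerW W (P (n + 1)) (divDiff (starRingEnd ℂ z) (P n * G)) * gamma W P n
        * evalAt (P (n + 1)) z
      - innerW W (P (n + 1)) (divDiff (starRingEnd ℂ z) (P (n + 1) * G)) * gamma W P n
        * evalAt (P n) z = -innerW W (P (n + 1)) (κ * G) := by
    rw [← hC, ← hC, ← hW.innerW_neg_right, ← divDiff_C_sub_X_mul (starRingEnd ℂ z), ← mul_assoc,
      hcd, ← hW.innerW_sub_right, sub_mul, mul_assoc, mul_assoc, ← divDiff_C_mul,
      ← divDiff_C_mul, sub_eq_add_neg, sub_eq_add_neg, divDiff_add]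
    congr 2
    exact (map_neg (AddMonoidHom.mk' _ (divDiff_add _)) _).symm
  have hκd : (derivative κ).degree < (n + 1 : ℕ) :=
    (degree_derivative_le).trans_lt (hP.degree_cdKernel z (n + 1))
  have hPd : (derivative (P (n + 1))).degree < (n + 1 : ℕ) := by
    rcases eq_or_ne (P (n + 1)) 0 with h | h
    · simp [h]
    · exact (degree_derivative_lt h).trans_le (hP.degree_le _)
  have h3 := hD (P (n + 1)) κ
  rw [covDeriv, covDeriv, hW.innerW_add_left, hW.innerW_add_right,
    hP.orthogonal _ _ hκd, hP.innerW_cdKernel hW z hPd, zero_add] at h3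
  simp only [ladderForm, add_mul]
  rw [add_sub_add_comm, h1, h2, covDeriv, evalAt_add, ← sub_eq_zero, ← h3]
  abel

end Ladder

/-! ### The coefficients of the ladder relation -/

section Coefficients

variable {N : ℕ} {W : ℝ → Mat N} {P : ℕ → (Mat N)[X]} {G : (Mat N)[X]}

theorem coeff_iterate_divX (F : (Mat N)[X]) (k t : ℕ) :
    (divX^[k] F).coeff t = F.coeff (t + k) := by
  induction k generalizing t with
  | zero => rfl
  | succ k ih => rw [Function.iterate_succ_apply', coeff_divX, ih, add_assoc, add_comm 1 k]

theorem divDiff_eq_divX (z : ℂ) (F : (Mat N)[X]) :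
    divDiff z F = C (evalAt (divX F) z) + X * divDiff z (divX F) := by
  refine divDiff_unique (r := z • evalAt (divX F) z + F.coeff 0) ?_
  rw [mul_add, ← mul_assoc _ X, ← X_mul, mul_assoc, C_sub_X_mul_divDiff, sub_mul, ← C_mul,
    smul_one_mul, mul_sub, C_add]
  have h := X_mul_divX_add F
  generalize F.divX = e at h ⊢
  generalize F.coeff 0 = c at h ⊢
  rw [← h]
  abel

theorem divDiff_eq_sum (z : ℂ) {F : (Mat N)[X]} {L : ℕ} (hF : F.natDegree ≤ L) :
    divDiff z F = ∑ k ∈ Finset.range L, C (evalAt (divX^[k + 1] F) z) * X ^ k := by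
  induction L generalizing F with
  | zero =>
    refine divDiff_unique (r := F.coeff 0) ?_
    rw [← eq_C_of_natDegree_le_zero hF, Finset.sum_range_zero, mul_zero, sub_self]
  | succ L ih =>
    have hd : (divX F).natDegree ≤ L := by
      rw [natDegree_divX_eq_natDegree_tsub_one]
      omega
    have hs : ∀ k, C (evalAt (divX^[k + 1 + 1] F) z) * X ^ (k + 1) =
        X * (C (evalAt (divX^[k + 1] (divX F)) z) * X ^ k) := fun k => by
      rw [← mul_assoc, X_mul_C, mul_assoc, ← pow_succ', Function.iterate_succ_apply _ (k + 1)]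
    rw [Finset.sum_range_succ', divDiff_eq_divX, ih hd, Finset.mul_sum, add_comm,
      Finset.sum_congr rfl fun k _ => hs k, pow_zero, mul_one, zero_add, Function.iterate_one]

theorem IsMonicMOPRL.coeff_truncPoly (hP : IsMonicMOPRL W P) (n k t : ℕ) :
    (truncPoly P n k).coeff t = if k ≤ t + n then (P n).coeff (t + n - k) else 0 := by
  have h1 : (truncPoly P n k).coeff t = if t ≤ k then coeffDown P n (k - t) else 0 := by
    rw [truncPoly, finsetSum_coeff]
    simp only [coeff_monomial]
    split_ifs with h
    · rw [Finset.sum_eq_single (k - t)]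
      · rw [if_pos (by omega)]
      · intro s hs hne
        have := Finset.mem_range.1 hs
        rw [if_neg (by omega)]
      · intro hs
        exact absurd (Finset.mem_range.2 (by omega)) hs
    · refine Finset.sum_eq_zero fun s _ => ?_
      rw [if_neg (by omega)]
  rw [h1]
  by_cases h : t ≤ k
  · rw [if_pos h, coeffDown]
    by_cases hk : k ≤ t + n
    · rw [if_pos hk, if_pos (by omega)]
      congr 1
      omega
    · rw [if_neg hk, if_neg (by omega)]
  · rw [if_neg h, if_pos (by omega)]
    exact (coeff_eq_zero_of_natDegree_lt ((hP.natDegree_le n).trans_lt (by omega))).symm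

/-- Δ_{j,n} is the polynomial part of z^{-(n+m-j)} Pₙ(z) G(z): the terms of G of degree below m - j
are too low to contribute. These are the coefficients in the expansion of the divided difference of
Pₙ G. -/
theorem IsMonicMOPRL.coeff_Delta (hP : IsMonicMOPRL W P) (n t : ℕ) {j : ℕ}
    (hj : j ≤ G.natDegree) :
    (Delta P G j n).coeff t = (P n * G).coeff (t + (n + G.natDegree - j)) := by
  refine Eq.trans ?_ (congrArg (fun F => (P n * F).coeff (t + (n + G.natDegree - j)))
    G.as_sum_range_C_mul_X_pow).symm
  rw [show G.natDegree + 1 = G.natDegree - j + (j + 1) by omega, Finset.sum_range_add, mul_add,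
    coeff_add, Finset.mul_sum, Finset.mul_sum, finsetSum_coeff, finsetSum_coeff, Delta,
    finsetSum_coeff, Finset.sum_eq_zero (s := Finset.range (G.natDegree - j)), zero_add]
  · refine Finset.sum_congr rfl fun k hk => ?_
    have hk := Finset.mem_range.1 hk
    rw [coeff_mul_C, hP.coeff_truncPoly, ← mul_assoc, coeff_mul_X_pow', coeff_mul_C]
    by_cases h : k ≤ t + n
    · rw [if_pos h, if_pos (by omega)]
      congr 2
      omega
    · rw [if_neg h, if_neg (by omega), zero_mul]
  · intro i hi
    have hi := Finset.mem_range.1 hi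
    rw [← mul_assoc, coeff_mul_X_pow', if_pos (by omega), coeff_mul_C,
      coeff_eq_zero_of_natDegree_lt ((hP.natDegree_le n).trans_lt (by omega)), zero_mul]

theorem IsMonicMOPRL.Delta_eq_divX (hP : IsMonicMOPRL W P) (n : ℕ) {j : ℕ}
    (hj : j ≤ G.natDegree) :
    Delta P G j n = divX^[n + G.natDegree - j] (P n * G) := by
  ext1 t
  rw [hP.coeff_Delta n t hj, coeff_iterate_divX]

theorem bCoeff_eq_innerW (n k : ℕ) : bCoeff W P n k = innerW W (P n) (X ^ k) := by
  ext i j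
  simp [bCoeff, innerW, matIntegral, Matrix.conjTranspose_smul]

theorem IsMonicMOPRL.bCoeff_eq_zero (hP : IsMonicMOPRL W P) {n k : ℕ} (h : k < n) :
    bCoeff W P n k = 0 := by
  rw [bCoeff_eq_innerW]
  exact hP.orthogonal _ _ ((degree_X_pow_le k).trans_lt (by exact_mod_cast h))

/-- The expansion of the divided difference of `Pₙ G` against an orthogonal polynomial. -/
theorem IsMonicMOPRL.innerW_divDiff (hP : IsMonicMOPRL W P) (hW : IsWeight W) (z : ℂ)
    {n n' K : ℕ} (hK : K ≤ G.natDegree + 1) (hK' : K ≤ n + G.natDegree)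
    (hn : n + G.natDegree ≤ n' + K) :
    innerW W (divDiff z (P n * G)) (P n') =
      ∑ j ∈ Finset.range K, evalAt (Delta P G j n) z
        * (bCoeff W P n' (n + G.natDegree - 1 - j)).conjTranspose := by
  have hdeg : (P n * G).natDegree ≤ n + G.natDegree :=
    natDegree_mul_le.trans (Nat.add_le_add_right (hP.natDegree_le n) _)
  have hterm : ∀ k, innerW W (C (evalAt (divX^[k + 1] (P n * G)) z) * X ^ k) (P n') =
      evalAt (divX^[k + 1] (P n * G)) z * (bCoeff W P n' k).conjTranspose := fun k => by
    rw [hW.innerW_C_mul_left, bCoeff_eq_innerW, hW.innerW_conjTranspose]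
  rw [divDiff_eq_sum z hdeg, hW.innerW_sum_left, ← Finset.sum_range_reflect]
  simp only [hterm]
  symm
  -- For j ≥ K the moment index is below n', so orthogonality removes the term.
  refine Finset.sum_subset_zero_on_sdiff (Finset.range_mono hK') (fun j hj => ?_) fun j hj => ?_
  · rw [Finset.mem_sdiff, Finset.mem_range, Finset.mem_range] at hj
    rw [hP.bCoeff_eq_zero (k := n + G.natDegree - 1 - j) (by omega), Matrix.conjTranspose_zero,
      mul_zero]
  · have hj := Finset.mem_range.1 hj
    rw [hP.Delta_eq_divX n (show j ≤ G.natDegree by omega),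
      show n + G.natDegree - 1 - j + 1 = n + G.natDegree - j by omega]

theorem IsMonicMOPRL.evalAt_calA (hP : IsMonicMOPRL W P) (hW : IsWeight W) (n : ℕ) (z : ℂ) :
    evalAt (calA W P G n) z = -(gamma W P n * ladderForm W G z (P n) (P n)) := by
  have h := fun z => hP.innerW_divDiff (G := G) hW z (n := n) (n' := n) (K := G.natDegree)
    (by omega) (by omega) le_rfl
  have hi : ∀ j, n + G.natDegree - j - 1 = n + G.natDegree - 1 - j := fun j => by omega
  rw [ladderForm, ← hW.innerW_conjTranspose (divDiff _ _), h, h, Matrix.conjTranspose_sum,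
    ← Finset.sum_add_distrib, calA]
  simp only [evalAt_neg, evalAt_mul, evalAt_C, evalAt_sum, evalAt_add, evalAt_starPoly, hi,
    Matrix.conjTranspose_mul, Matrix.conjTranspose_conjTranspose, add_comm]

theorem IsMonicMOPRL.evalAt_starPoly_calA (hP : IsMonicMOPRL W P) (hW : IsWeight W) (n : ℕ)
    (z : ℂ) :
    evalAt (starPoly (calA W P G n)) z = -(ladderForm W G z (P n) (P n) * gamma W P n) := by
  rw [evalAt_starPoly, hP.evalAt_calA hW, Matrix.conjTranspose_neg, Matrix.conjTranspose_mul,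
    gamma_conjTranspose hW, ladderForm_conjTranspose hW]

theorem IsMonicMOPRL.evalAt_calB_succ (hP : IsMonicMOPRL W P) (hW : IsWeight W) (n : ℕ) (z : ℂ) :
    evalAt (calB W P G (n + 1)) z =
      -(ladderForm W G z (P (n + 1)) (P n) * gamma W P n) := by
  have h1 := hP.innerW_divDiff (G := G) hW z (n := n + 1) (n' := n) (K := G.natDegree + 1)
    le_rfl (by omega) (by omega)
  have h2 : innerW W (divDiff (starRingEnd ℂ z) (P n * G)) (P (n + 1)) =
      ∑ j ∈ Finset.range (G.natDegree + 1), evalAt (Delta P G j n) (starRingEnd ℂ z)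
        * (bCoeff W P (n + 1) (n + G.natDegree - 1 - j)).conjTranspose := by
    rw [hP.innerW_divDiff (G := G) hW _ (K := G.natDegree) (by omega) (by omega) (by omega),
      -- The added term j = m is zero; it only matches the summation range of `calB`.
      Finset.sum_range_succ, hP.bCoeff_eq_zero (k := n + G.natDegree - 1 - G.natDegree) (by omega),
      Matrix.conjTranspose_zero, mul_zero, add_zero]
  have hi : ∀ j, n + G.natDegree - j - 1 = n + G.natDegree - 1 - j := fun j => by omega
  have hi' : ∀ j, n + 1 + G.natDegree - 1 - j = n + G.natDegree - j := fun j => by omega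
  rw [ladderForm, ← hW.innerW_conjTranspose (divDiff _ _), h1, h2, Matrix.conjTranspose_sum,
    ← Finset.sum_add_distrib, calB]
  simp only [evalAt_neg, evalAt_mul, evalAt_C, evalAt_sum, evalAt_add, evalAt_starPoly, hi, hi',
    Matrix.conjTranspose_mul, Matrix.conjTranspose_conjTranspose]

/-- The lowering relation `Pₙ' + Pₙ G = -ℬₙ Pₙ + 𝒜ₙ* βₙ Pₙ₋₁`. -/
theorem IsMonicMOPRL.covDeriv_add_calB_mul (hP : IsMonicMOPRL W P) (hW : IsWeight W)
    (hD : ∀ F Q, innerW W (covDeriv G F) Q + innerW W F (covDeriv G Q) = 0) (n : ℕ) :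
    covDeriv G (P n) + calB W P G n * P n =
      starPoly (calA W P G n) * C (beta W P n) * P (n - 1) := by
  refine evalAt_injective fun z => ?_
  simp only [evalAt_add, evalAt_mul, evalAt_C]
  rcases n with _ | n
  · simp [beta, calB, covDeriv, hP.apply_zero]
  · rw [hP.ladder hW hD, hP.evalAt_calB_succ hW, hP.evalAt_starPoly_calA hW, Nat.add_sub_cancel,
      neg_mul (ladderForm _ _ _ _ _ * _) (beta _ _ _), mul_assoc _ (gamma _ _ _) (beta _ _ _),
      hP.gamma_mul_beta hW]
    simp only [neg_mul]
    abel

/-- This is the adjoint of `ladderForm_recurrence`, multiplied by γₙ. For n ≥ 1 the boundary term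
vanishes by orthogonality to 1; for n = 0 it equals G, which is why ℬ₀ = -G. -/
theorem IsMonicMOPRL.ladderForm_raise (hP : IsMonicMOPRL W P) (hW : IsWeight W)
    (hD : ∀ F Q, innerW W (covDeriv G F) Q + innerW W F (covDeriv G Q) = 0) (n : ℕ) (z : ℂ) :
    -evalAt (calB W P G n) z
        + evalAt (starPoly (calA W P G n)) z * (z • (1 : Mat N) - alpha P n) =
      -(ladderForm W G z (P n) (P (n + 1)) * gamma W P n) := by
  have h := congrArg (fun A => A.conjTranspose * gamma W P n)
    (hP.ladderForm_recurrence hW hD (starRingEnd ℂ z) n)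
  simp only [Matrix.conjTranspose_add, Matrix.conjTranspose_sub, Matrix.conjTranspose_mul,
    Matrix.conjTranspose_smul, ladderForm_conjTranspose hW, Matrix.conjTranspose_conjTranspose,
    Complex.star_def, Complex.conj_conj, add_mul, sub_mul, mul_assoc,
    hP.gamma_mul_alpha hW, hW.innerW_conjTranspose] at h
  rw [hP.evalAt_starPoly_calA hW, mul_sub, mul_smul_one, neg_mul, mul_assoc, smul_neg]
  rw [← sub_eq_zero] at h ⊢
  rw [← h]
  rcases n with _ | n
  · have h1 := hP.mul_gamma hW 0
    rw [hP.apply_zero] at h1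
    simp only [beta, calB, hP.apply_zero, evalAt_neg, one_mul, h1, Matrix.conjTranspose_zero,
      zero_mul, mul_zero, mul_one, smul_mul_assoc]
    abel
  · rw [hP.beta_mul_gamma hW, hP.evalAt_calB_succ hW, Nat.add_sub_cancel,
      hP.orthogonal' hW (degree_one_le.trans_lt (by exact_mod_cast n.succ_pos)), zero_mul,
      mul_zero, smul_mul_assoc]
    abel

/-- The compatibility of the lowering relation with the three-term recurrence. -/
theorem IsMonicMOPRL.compatibility (hP : IsMonicMOPRL W P) (hW : IsWeight W)
    (hD : ∀ F Q, innerW W (covDeriv G F) Q + innerW W F (covDeriv G Q) = 0) (n : ℕ) (z : ℂ) :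
    beta W P n * (-evalAt (calB W P G (n - 1)) z
        + evalAt (starPoly (calA W P G (n - 1))) z * (z • (1 : Mat N) - alpha P (n - 1))) =
      (z • (1 : Mat N) - alpha P n) * evalAt (starPoly (calA W P G n)) z * beta W P n
        - evalAt (calB W P G (n + 1)) z * beta W P n := by
  rcases n with _ | n
  · simp [beta]
  -- The factor γₙ is γₙ₊₁ βₙ₊₁, so it turns the first two values of the form into ℬₙ₊₂ βₙ₊₁ and
  -- 𝒜ₙ₊₁* βₙ₊₁, up to sign.
  have h := congrArg (fun A => A * gamma W P n) (hP.ladderForm_recurrence hW hD z (n + 1))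
  have h1 : innerW W (P (n + 1)) 1 = 0 :=
    hP.orthogonal _ _ (degree_one_le.trans_lt (by exact_mod_cast n.succ_pos))
  simp only [h1, zero_mul, sub_zero, add_mul, mul_assoc, Nat.add_sub_cancel] at h
  rw [Nat.add_sub_cancel, hP.ladderForm_raise hW hD, hP.evalAt_starPoly_calA hW,
    hP.evalAt_calB_succ hW, mul_assoc, neg_mul (ladderForm _ _ _ _ _ * _) (beta _ _ _),
    neg_mul (ladderForm _ _ _ _ _ * _) (beta _ _ _), mul_assoc _ (gamma _ _ _) (beta _ _ _),
    mul_assoc _ (gamma _ _ _) (beta _ _ _), hP.gamma_mul_beta hW, mul_neg, mul_neg, sub_mul,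
    smul_one_mul]
  rw [smul_mul_assoc] at h
  rw [← h]
  abel

end Coefficients

/-! ### Elimination of Pₙ₋₁ and the second-order equation -/

/-- The noncommutative elimination behind the second-order equation. -/
theorem second_order_of_ladder {R : Type*} [Ring R]
    {p p₁ p₂ g g₁ a a₁ b b₁ b' c κ w β q q₁ M : R}
    (h0 : p₁ + p * g + b * p = a * β * q)
    (h1 : p₂ + p₁ * g + p * g₁ + b₁ * p + b * p₁ = a₁ * β * q + a * β * q₁)
    (h2 : β * (q₁ + q * g) = β * κ * q - β * c * p)
    (h3 : β * κ = w * a * β - b' * β)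
    (hM : M * a = -a₁ + b * a - a * w * a + a * b') :
    p₂ + (p₁ * g + p₁ * g) + p * (g₁ + g ^ 2) + M * p₁
      + (M * b - b ^ 2 + b₁ + a * β * c) * p + M * p * g = 0 := by
  -- The left side is a combination of the defects of the five hypotheses, with `h0` entering twice:
  -- times g on the right and times M - b on the left.
  have key : p₂ + (p₁ * g + p₁ * g) + p * (g₁ + g ^ 2) + M * p₁
      + (M * b - b ^ 2 + b₁ + a * β * c) * p + M * p * g =
      (p₂ + p₁ * g + p * g₁ + b₁ * p + b * p₁ - (a₁ * β * q + a * β * q₁))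
      + (p₁ + p * g + b * p - a * β * q) * g
      + (M - b) * (p₁ + p * g + b * p - a * β * q)
      + a * (β * (q₁ + q * g) - (β * κ * q - β * c * p))
      + a * (β * κ - (w * a * β - b' * β)) * q
      + (M * a - (-a₁ + b * a - a * w * a + a * b')) * β * q := by
    noncomm_ring
  rw [key, h0, h1, h2, h3, hM]
  simp

/-- At each z the two values are conjugate: 𝒜ₙ* = γₙ⁻¹ 𝒜ₙ γₙ, by the Hermitian symmetry of
`ladderForm`. -/
theorem IsMonicMOPRL.isUnit_starPoly_calA {N : ℕ} {W : ℝ → Mat N} {P : ℕ → (Mat N)[X]}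
    {G : (Mat N)[X]} (hP : IsMonicMOPRL W P) (hW : IsWeight W) {n : ℕ} {z : ℂ}
    (hA : IsUnit (evalAt (calA W P G n) z)) : IsUnit (evalAt (starPoly (calA W P G n)) z) := by
  have hg : IsUnit (gamma W P n) := .of_mul_eq_one _ (hP.gamma_mul hW n)
  have h : evalAt (starPoly (calA W P G n)) z =
      innerW W (P n) (P n) * evalAt (calA W P G n) z * gamma W P n := by
    rw [hP.evalAt_starPoly_calA hW, hP.evalAt_calA hW, mul_neg, ← mul_assoc, hP.mul_gamma hW,
      one_mul, neg_mul]
  rw [h]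
  exact ((hW.isUnit_innerW_self (hP.coeff_self n)).mul hA).mul hg

end MOPRL

theorem mainTheorem9 (N : ℕ) (W T : ℝ → MOPRL.Mat N) (G : (MOPRL.Mat N)[X])
    (hW : MOPRL.IsWeight W)
    (hWT : ∀ x : ℝ, W x = T x * (T x).conjTranspose)
    (hTG : ∀ x : ℝ, HasDerivAt T (MOPRL.evalAt G x * T x) x)
    (P : ℕ → (MOPRL.Mat N)[X]) (hP : MOPRL.IsMonicMOPRL W P)
    (n : ℕ) (z : ℂ) (hA : IsUnit (MOPRL.evalAt (MOPRL.calA W P G n) z)) :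
    MOPRL.evalAt (derivative (derivative (P n))) z
      + (2 : ℂ) • (MOPRL.evalAt (derivative (P n)) z * MOPRL.evalAt G z)
      + MOPRL.evalAt (P n) z * (MOPRL.evalAt (derivative G) z + MOPRL.evalAt G z ^ 2)
      + MOPRL.calM W P G n z * MOPRL.evalAt (derivative (P n)) z
      + MOPRL.calN W P G n z * MOPRL.evalAt (P n) z
      + MOPRL.calM W P G n z * MOPRL.evalAt (P n) z * MOPRL.evalAt G z = 0 := by
  have hD := MOPRL.innerW_covDeriv hW hWT hTG
  have hlow := hP.covDeriv_add_calB_mul hW hD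
  have h0 := congrArg (fun F => MOPRL.evalAt F z) (hlow n)
  have h1 := congrArg (fun F => MOPRL.evalAt (derivative F) z) (hlow n)
  have hinv := Matrix.nonsing_inv_mul _
    ((Matrix.isUnit_iff_isUnit_det _).1 (hP.isUnit_starPoly_calA hW hA))
  simp only [MOPRL.covDeriv, MOPRL.evalAt_add, MOPRL.evalAt_mul, MOPRL.evalAt_C] at h0
  simp only [MOPRL.covDeriv, derivative_add, derivative_mul, derivative_C, mul_zero, add_zero,
    MOPRL.evalAt_add, MOPRL.evalAt_mul, MOPRL.evalAt_C, ← add_assoc] at h1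
  -- The lowering relation at n - 1, with βₙ₋₁ Pₙ₋₂ replaced through the recurrence. The left factor
  -- βₙ makes the case n = 0 trivial.
  have h2 : MOPRL.beta W P n * (MOPRL.evalAt (derivative (P (n - 1))) z
        + MOPRL.evalAt (P (n - 1)) z * MOPRL.evalAt G z) =
      MOPRL.beta W P n * (-MOPRL.evalAt (MOPRL.calB W P G (n - 1)) z
        + MOPRL.evalAt (MOPRL.starPoly (MOPRL.calA W P G (n - 1))) z
          * (z • (1 : MOPRL.Mat N) - MOPRL.alpha P (n - 1))) * MOPRL.evalAt (P (n - 1)) z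
      - MOPRL.beta W P n * MOPRL.evalAt (MOPRL.starPoly (MOPRL.calA W P G (n - 1))) z
        * MOPRL.evalAt (P n) z := by
    rcases n with _ | n
    · simp [MOPRL.beta]
    have hl := congrArg (fun F => MOPRL.evalAt F z) (hlow n)
    have hr := congrArg (fun F => MOPRL.evalAt F z) (hP.X_mul hW n)
    simp only [MOPRL.covDeriv, MOPRL.evalAt_add, MOPRL.evalAt_mul, MOPRL.evalAt_C,
      MOPRL.evalAt_X] at hl hr
    rw [Nat.add_sub_cancel, mul_assoc, mul_assoc, ← mul_sub, eq_sub_of_add_eq hl]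
    have hr' : MOPRL.beta W P n * MOPRL.evalAt (P (n - 1)) z =
        (z • (1 : MOPRL.Mat N) - MOPRL.alpha P n) * MOPRL.evalAt (P n) z
          - MOPRL.evalAt (P (n + 1)) z := by
      rw [sub_mul, hr]
      abel
    rw [mul_assoc _ (MOPRL.beta W P n), hr']
    simp only [mul_sub, sub_mul, mul_add, add_mul, neg_mul, mul_neg, mul_assoc]
    abel
  rw [two_smul]
  refine MOPRL.second_order_of_ladder h0 h1 h2 (hP.compatibility hW hD n z) ?_
  rw [MOPRL.calM]
  simp only [add_mul, sub_mul, neg_mul, mul_assoc, hinv, mul_one]
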